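/- For a prime $p$ and $x=\sum_{n\ge v(x)}a_np^n\in\mathbb{Q}_p$ with digits $a_n\in\{0,\dots,p-1\}$, let $f_p(x)=\sum_{v(x)\le n<0}a_np^n\in\mathbb{Q}$ be the fractional part of $x$ (so $f_p(x)=0$ for $x\in\mathbb{Z}_p$), and put $\chi_p(x)=\exp(2\pi\sqrt{-1}\,f_p(x))$; for $x\in\mathbb{R}$ put $\chi_\infty(x)=\exp(-2\pi\sqrt{-1}\,x)$. Let $\mathbb{A}=\mathbb{A}_{\mathrm{fin}}\times\mathbb{R}$ be the ring of adeles of $\mathbb{Q}$, where $\mathbb{A}_{\mathrm{fin}}=\prod_p(\mathbb{Q}_p:\mathbb{Z}_p)$ is the restricted product over all primes with the restricted product topology, and regard $\mathbb{Q}$ as a subgroup of $\mathbb{A}$ by the diagonal embedding. For a topological abelian group $G$ let $\widehat{G}$ be its unitary dual, i.e. the group of continuous homomorphisms from $G$ to the circle group, with the compact-open topology. Let $\chi_{\mathbb{Q}}=\prod_{p\le\infty}\chi_p\in\widehat{\mathbb{A}}$, and for $t\in\mathbb{A}$ let $\chi_{\mathbb{Q},t}\in\widehat{\mathbb{A}}$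 be given by $\chi_{\mathbb{Q},t}(x)=\chi_{\mathbb{Q}}(tx)$. Theorem. For every $q\in\mathbb{Q}$ the character $\chi_{\mathbb{Q},q}$ is trivial on $\mathbb{Q}$, hence defines a unitary character of the adele class group $\mathbb{A}/\mathbb{Q}$ (with the quotient topology), and the map $$\mathbb{Q}\to\widehat{\mathbb{A}/\mathbb{Q}},\qquad q\mapsto\chi_{\mathbb{Q},q},$$ is an isomorphism of topological groups, where $\mathbb{Q}$ carries the discrete topology. Moreover, the annihilator $\mathbb{Q}^\perp=\{\chi\in\widehat{\mathbb{A}}:\chi|_{\mathbb{Q}}=1\}$ of $\mathbb{Q}$ is $\mathbb{Q}$ itself under $t\mapsto\chi_{\mathbb{Q},t}$: one has $\mathbb{Q}^\perp=\{\chi_{\mathbb{Q},q}:q\in\mathbb{Q}\}$, and for $t\in\mathbb{A}$ one has $\chi_{\mathbb{Q},t}\in\mathbb{Q}^\perp$ if and only if $t\in\mathbb{Q}$. -/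

import Mathlib

open scoped RestrictedProduct

noncomputable section

/-! ### Unitary duals and annihilators of additive topological groups -/

/-- The unitary dual of an additive abelian topological group `G`: the group of continuous
homomorphisms from `G` to the circle group, with the compact-open topology. -/
abbrev UnitaryDual (G : Type*) [AddCommGroup G] [TopologicalSpace G] : Type _ :=
  PontryaginDual (Multiplicative G)

/-- The annihilator of a subgroup `H` of `G`: the unitary characters of `G` trivial on `H`. -/
def unitaryAnnihilator {G : Type*} [AddCommGroup G] [TopologicalSpace G] (H : AddSubgroup G) :
    Subgroup (UnitaryDual G) where
  carrier := {χ | ∀ h ∈ H, χ (Multiplicative.ofAdd h) = 1}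
  one_mem' := fun _ _ => rfl
  mul_mem' := by
    intro χ ψ hχ hψ h hh
    have : (χ * ψ) (Multiplicative.ofAdd h)
      = χ (Multiplicative.ofAdd h) * ψ (Multiplicative.ofAdd h) := rfl
    rw [this, hχ h hh, hψ h hh, one_mul]
  inv_mem' := by
    intro χ hχ h hh
    have : χ⁻¹ (Multiplicative.ofAdd h) = (χ (Multiplicative.ofAdd h))⁻¹ := rfl
    rw [this, hχ h hh, inv_one]

/-! ### The adele ring of `ℚ` -/

instance instFactPrimeOfPrimes (p : Nat.Primes) : Fact (p : ℕ).Prime := ⟨p.2⟩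

instance instFactIsOpenPadicInt :
    Fact (∀ p : Nat.Primes, IsOpen (PadicInt.subring (p : ℕ) : Set ℚ_[(p : ℕ)])) := by
  refine ⟨fun p => ?_⟩
  have h : (PadicInt.subring (p : ℕ) : Set ℚ_[(p : ℕ)]) = Metric.closedBall 0 1 := by
    ext x
    simp [PadicInt.mem_subring_iff]
  rw [h]
  exact IsUltrametricDist.isOpen_closedBall 0 one_ne_zero

/-- The ring of finite adeles: the restricted product of the fields `ℚ_p` with respect to the
rings `ℤ_p`, with the restricted product topology. -/
abbrev RatFiniteAdele : Type :=
  Πʳ p : Nat.Primes, [ℚ_[(p : ℕ)], PadicInt.subring (p : ℕ)]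

/-- The ring of adeles `𝔸 = 𝔸_fin × ℝ`, with the product topology. -/
abbrev RatAdele : Type := RatFiniteAdele × ℝ

theorem eventually_ratCast_mem_padicInt (q : ℚ) :
    ∀ᶠ p : Nat.Primes in Filter.cofinite, (q : ℚ_[(p : ℕ)]) ∈ PadicInt.subring (p : ℕ) := by
  rw [Filter.eventually_cofinite]
  have hfin : {p : Nat.Primes | (p : ℕ) ∈ q.den.primeFactors}.Finite :=
    Set.Finite.preimage Subtype.val_injective.injOn (Finset.finite_toSet q.den.primeFactors)
  refine hfin.subset fun p hp => ?_
  by_contra h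
  refine hp (Padic.norm_rat_le_one fun hd => h ?_)
  exact Nat.mem_primeFactors.2 ⟨p.2, hd, q.den_nz⟩

/-- The diagonal embedding `ℚ → 𝔸`. -/
def ratAdeleDiag : ℚ →+* RatAdele where
  toFun q := (⟨fun p => (q : ℚ_[(p : ℕ)]), eventually_ratCast_mem_padicInt q⟩, (q : ℝ))
  map_one' := by
    refine Prod.ext (RestrictedProduct.ext _ _ fun p => ?_) ?_
    · exact Rat.cast_one
    · exact Rat.cast_one
  map_mul' a b := by
    refine Prod.ext (RestrictedProduct.ext _ _ fun p => ?_) ?_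
    · exact Rat.cast_mul a b
    · exact Rat.cast_mul a b
  map_zero' := by
    refine Prod.ext (RestrictedProduct.ext _ _ fun p => ?_) ?_
    · exact Rat.cast_zero
    · exact Rat.cast_zero
  map_add' a b := by
    refine Prod.ext (RestrictedProduct.ext _ _ fun p => ?_) ?_
    · exact Rat.cast_add a b
    · exact Rat.cast_add a b

/-- The rational numbers, as a subgroup of the adeles. -/
def ratPrincipalAdele : AddSubgroup RatAdele := ratAdeleDiag.toAddMonoidHom.range

/-- The adele class group `𝔸/ℚ`, with the quotient topology. -/
abbrev RatAdeleClassGroup : Type := RatAdele ⧸ ratPrincipalAdele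

/-! ### The local characters -/

section Local

variable (p : ℕ) [Fact p.Prime]

theorem padic_norm_pow_mul_le_one (x : ℚ_[p]) :
    ‖(p : ℚ_[p]) ^ (-x.valuation).toNat * x‖ ≤ 1 := by
  by_cases hx : x = 0
  · simp [hx]
  have hp : (1 : ℝ) ≤ p := by exact_mod_cast (Fact.out : p.Prime).one_lt.le
  have hp0 : (p : ℝ) ≠ 0 := by positivity
  rw [norm_mul, norm_pow, Padic.norm_p, Padic.norm_eq_zpow_neg_valuation hx, inv_pow,
    ← zpow_natCast, ← zpow_neg, ← zpow_add₀ hp0]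
  refine zpow_le_one_of_nonpos₀ hp ?_
  omega

/-- The fractional part of a `p`-adic number `x = ∑ aₙ pⁿ` (`n ≥ v(x)`, digits
`aₙ ∈ {0, …, p - 1}`), namely the rational number `∑ aₙ pⁿ` over `v(x) ≤ n < 0`.
With `m = max (-v(x)) 0` one has `p ^ m * x ∈ ℤ_p`, and `PadicInt.appr _ m` is the natural number
given by its first `m` digits. -/
def padicFract (x : ℚ_[p]) : ℚ :=
  (PadicInt.appr (⟨(p : ℚ_[p]) ^ (-x.valuation).toNat * x, padic_norm_pow_mul_le_one p x⟩ : ℤ_[p])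
    (-x.valuation).toNat : ℚ) / (p : ℚ) ^ (-x.valuation).toNat

variable {p}

theorem padicFract_nonneg (x : ℚ_[p]) : 0 ≤ padicFract p x := by
  unfold padicFract
  positivity

theorem padicFract_lt_one (x : ℚ_[p]) : padicFract p x < 1 := by
  have hp : (0 : ℚ) < p := by exact_mod_cast (Fact.out : p.Prime).pos
  unfold padicFract
  rw [div_lt_one (by positivity)]
  exact_mod_cast PadicInt.appr_lt _ _

theorem padicFract_eq_zero {x : ℚ_[p]} (hx : ‖x‖ ≤ 1) : padicFract p x = 0 := by
  have h : (-x.valuation).toNat = 0 := by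
    have := (Padic.norm_le_one_iff_val_nonneg x).1 hx
    omega
  have h1 := PadicInt.appr_lt
    (⟨(p : ℚ_[p]) ^ (-x.valuation).toNat * x, padic_norm_pow_mul_le_one p x⟩ : ℤ_[p])
    (-x.valuation).toNat
  have h2 : p ^ (-x.valuation).toNat = 1 := by rw [h, pow_zero]
  rw [h2, Nat.lt_one_iff] at h1
  unfold padicFract
  rw [h1]
  simp

theorem exists_padicFract_eq_div_pow (x : ℚ_[p]) :
    ∃ (a m : ℕ), padicFract p x = (a : ℚ) / (p : ℚ) ^ m := ⟨_, _, rfl⟩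

/-- The integral part `x - f(x)` is a `p`-adic integer. -/
theorem norm_sub_padicFract_le_one (x : ℚ_[p]) : ‖x - (padicFract p x : ℚ_[p])‖ ≤ 1 := by
  have hp0 : (p : ℚ_[p]) ≠ 0 := by exact_mod_cast (Fact.out : p.Prime).ne_zero
  obtain ⟨c, hc⟩ := Ideal.mem_span_singleton.1 (PadicInt.appr_spec (-x.valuation).toNat
    (⟨(p : ℚ_[p]) ^ (-x.valuation).toNat * x, padic_norm_pow_mul_le_one p x⟩ : ℤ_[p]))
  have h := congrArg (fun z : ℤ_[p] => (z : ℚ_[p])) hc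
  replace h : (p : ℚ_[p]) ^ (-x.valuation).toNat * x
      - (PadicInt.appr (⟨(p : ℚ_[p]) ^ (-x.valuation).toNat * x, padic_norm_pow_mul_le_one p x⟩ :
          ℤ_[p]) (-x.valuation).toNat : ℚ_[p]) = (p : ℚ_[p]) ^ (-x.valuation).toNat * c := by
    have h3 := h.trans (PadicInt.coe_mul _ _)
    rw [PadicInt.coe_pow, PadicInt.coe_natCast] at h3
    rw [← h3]
    refine Eq.trans ?_ (PadicInt.coe_sub _ _).symm
    rw [PadicInt.coe_natCast]
  have h2 : x - (padicFract p x : ℚ_[p]) = c := by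
    unfold padicFract
    rw [Rat.cast_div, Rat.cast_pow, Rat.cast_natCast, Rat.cast_natCast, sub_eq_iff_eq_add]
    rw [sub_eq_iff_eq_add] at h
    refine mul_left_cancel₀ (pow_ne_zero (-x.valuation).toNat hp0) ?_
    refine h.trans ?_
    rw [mul_add, mul_div_cancel₀ _ (pow_ne_zero _ hp0)]
  rw [h2]
  exact c.2

theorem exists_int_eq_of_padic {z : ℚ} {a : ℤ} {m : ℕ} (hz : z = (a : ℚ) / (p : ℚ) ^ m)
    (h : ‖(z : ℚ_[p])‖ ≤ 1) : ∃ k : ℤ, z = k := by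
  have hp0 : (p : ℚ) ≠ 0 := by exact_mod_cast (Fact.out : p.Prime).ne_zero
  have ha : (a : ℚ) = z * (p : ℚ) ^ m := by
    rw [hz]
    field_simp
  have ha' : (a : ℚ_[p]) = (z : ℚ_[p]) * (p : ℚ_[p]) ^ m := by exact_mod_cast ha
  have hdvd : (p : ℤ) ^ m ∣ a := by
    rw [← Padic.norm_int_le_pow_iff_dvd, ha', norm_mul, norm_pow, Padic.norm_p, zpow_neg,
      zpow_natCast, inv_pow]
    exact mul_le_of_le_one_left (by positivity) h
  obtain ⟨k, hk⟩ := hdvd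
  refine ⟨k, ?_⟩
  rw [hz, hk]
  push_cast
  field_simp

theorem exists_padicFract_add (x y : ℚ_[p]) :
    ∃ k : ℤ, padicFract p (x + y) = padicFract p x + padicFract p y + k := by
  have hp0 : (p : ℚ) ≠ 0 := by exact_mod_cast (Fact.out : p.Prime).ne_zero
  obtain ⟨a, i, ha⟩ := exists_padicFract_eq_div_pow (x + y)
  obtain ⟨b, j, hb⟩ := exists_padicFract_eq_div_pow x
  obtain ⟨c, l, hc⟩ := exists_padicFract_eq_div_pow y
  obtain ⟨k, hk⟩ := exists_int_eq_of_padic (p := p)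
    (z := padicFract p (x + y) - padicFract p x - padicFract p y)
    (a := (a : ℤ) * p ^ (j + l) - b * p ^ (i + l) - c * p ^ (i + j)) (m := i + j + l)
    (by
      rw [ha, hb, hc]
      push_cast
      field_simp
      ring) (by
      have h : ((padicFract p (x + y) - padicFract p x - padicFract p y : ℚ) : ℚ_[p])
          = (x - (padicFract p x : ℚ_[p])) + (y - (padicFract p y : ℚ_[p]))
            - ((x + y) - (padicFract p (x + y) : ℚ_[p])) := by
        push_cast
        ring
      rw [h]
      exact (PadicInt.subring p).sub_mem
        ((PadicInt.subring p).add_mem (norm_sub_padicFract_le_one x) (norm_sub_padicFract_le_one y))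
        (norm_sub_padicFract_le_one (x + y)))
  exact ⟨k, by rw [← hk]; ring⟩

variable (p)

/-- The local character `χ_p(x) = exp (2πi f(x))` of `ℚ_p`, `f(x)` being the fractional part. -/
def padicChar (x : ℚ_[p]) : Circle := Circle.exp (2 * Real.pi * (padicFract p x : ℝ))

variable {p}

theorem padicChar_add (x y : ℚ_[p]) : padicChar p (x + y) = padicChar p x * padicChar p y := by
  obtain ⟨k, hk⟩ := exists_padicFract_add x y
  unfold padicChar
  rw [hk, ← Circle.exp_add, Circle.exp_eq_exp]
  exact ⟨k, by push_cast; ring⟩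

theorem padicChar_eq_one {x : ℚ_[p]} (hx : ‖x‖ ≤ 1) : padicChar p x = 1 := by
  simp [padicChar, padicFract_eq_zero hx]

end Local

/-- The local character `χ_∞(x) = exp (-2πi x)` of `ℝ`. -/
def realChar (x : ℝ) : Circle := Circle.exp (-(2 * Real.pi * x))

/-! ### The global character -/

/-- `∏_p χ_p(x_p)` over all primes; only finitely many factors differ from `1`. -/
def finiteAdeleChar (x : RatFiniteAdele) : Circle := ∏ᶠ p : Nat.Primes, padicChar (p : ℕ) (x p)

theorem finite_mulSupport_padicChar (x : RatFiniteAdele) :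
    (Function.mulSupport fun p : Nat.Primes => padicChar (p : ℕ) (x p)).Finite := by
  have h := x.eventually
  rw [Filter.eventually_cofinite] at h
  exact h.subset fun p hp hx => hp (padicChar_eq_one hx)

theorem finiteAdeleChar_add (x y : RatFiniteAdele) :
    finiteAdeleChar (x + y) = finiteAdeleChar x * finiteAdeleChar y := by
  unfold finiteAdeleChar
  rw [← finprod_mul_distrib (finite_mulSupport_padicChar x) (finite_mulSupport_padicChar y)]
  exact finprod_congr fun p => padicChar_add (x p) (y p)

theorem continuous_finiteAdeleChar : Continuous finiteAdeleChar := by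
  have hz : finiteAdeleChar 0 = 1 := by
    have h := finiteAdeleChar_add 0 0
    rw [add_zero] at h
    exact left_eq_mul.1 h
  let φ : Multiplicative RatFiniteAdele →* Circle :=
    { toFun := fun x => finiteAdeleChar x.toAdd
      map_one' := hz
      map_mul' := fun x y => finiteAdeleChar_add x.toAdd y.toAdd }
  have hφ : Continuous φ := by
    refine continuous_of_continuousAt_one φ ?_
    have hopen : IsOpen {x : RatFiniteAdele | ∀ p : Nat.Primes, x p ∈ PadicInt.subring (p : ℕ)} :=
      RestrictedProduct.isOpen_forall_mem instFactIsOpenPadicInt.out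
    have hmem : {x : RatFiniteAdele | ∀ p : Nat.Primes, x p ∈ PadicInt.subring (p : ℕ)} ∈
        nhds (0 : RatFiniteAdele) := hopen.mem_nhds fun p => (PadicInt.subring (p : ℕ)).zero_mem
    have hev : (fun _ => (1 : Circle)) =ᶠ[nhds (1 : Multiplicative RatFiniteAdele)] φ := by
      refine Filter.mem_of_superset (show _ ∈ nhds (1 : Multiplicative RatFiniteAdele) from hmem)
        fun x hx => ?_
      exact (finprod_eq_one_of_forall_eq_one fun p => padicChar_eq_one (hx p)).symm
    exact continuousAt_const.congr hev
  exact hφ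

/-- The unitary character `χ_ℚ = ∏_{p ≤ ∞} χ_p` of the adeles. -/
def ratAdeleChar : UnitaryDual RatAdele :=
  ({ toFun := fun x => finiteAdeleChar x.toAdd.1 * realChar x.toAdd.2
     map_one' := by
      have hz : finiteAdeleChar 0 = 1 := by
        have h := finiteAdeleChar_add 0 0
        rw [add_zero] at h
        exact left_eq_mul.1 h
      simp [realChar, hz]
     map_mul' := fun x y => by
      have hr : realChar (x.toAdd.2 + y.toAdd.2) = realChar x.toAdd.2 * realChar y.toAdd.2 := by
        unfold realChar
        rw [← Circle.exp_add]
        congr 1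
        ring
      simp only [toAdd_mul, Prod.fst_add, Prod.snd_add, finiteAdeleChar_add, hr]
      exact mul_mul_mul_comm _ _ _ _
     continuous_toFun := by
      have hr : Continuous realChar := by
        unfold realChar
        fun_prop
      exact (continuous_finiteAdeleChar.comp (continuous_fst.comp continuous_toAdd)).mul
        (hr.comp (continuous_snd.comp continuous_toAdd)) } :
    Multiplicative RatAdele →ₜ* Circle)

/-- For an adele `t`, the unitary character `χ_{ℚ,t}(x) = χ_ℚ(t x)` of the adeles. -/
def ratAdeleCharMul (t : RatAdele) : UnitaryDual RatAdele :=
  PontryaginDual.map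
    ({ toFun := fun x => Multiplicative.ofAdd (t * x.toAdd)
       map_one' := by simp
       map_mul' := fun x y => by simp [mul_add]
       continuous_toFun :=
        continuous_ofAdd.comp ((continuous_const_mul t).comp continuous_toAdd) } :
      Multiplicative RatAdele →ₜ* Multiplicative RatAdele) ratAdeleChar

theorem ratAdeleCharMul_apply (t x : RatAdele) :
    ratAdeleCharMul t (Multiplicative.ofAdd x) = ratAdeleChar (Multiplicative.ofAdd (t * x)) := rfl

end

/-! ### Fractional parts of finite adeles -/

/-! Subtracting from an adele the sum of its fractional parts makes every finite component integral,
and an integer shift then puts the real component in [0, 1]. So 𝔸 = ℚ + (∏ ℤ_p × [0, 1]), and 𝔸/ℚ is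
compact. A rational minus its fractional parts is an integer; with the minus sign in χ_∞, this makes
χ_ℚ trivial on ℚ.

Conversely, let χ be trivial on ℚ. The circle has no small subgroups, so χ kills N·∏ ℤ_p for some N
> 0 (`exists_pos_forall_natCast_mul_eq_one`). Then χ(N) = 1 forces χ(0, N) = 1, so on ℝ it is r ↦
exp(2πi k r / N) with k an integer. As 𝔸 is covered by ℚ, N·∏ ℤ_p and ℝ, these data determine χ, and
χ_{ℚ,-k/N} has the same ones.

Injectivity of t ↦ χ_{ℚ,t} is checked one place at a time. The dual of the compact group 𝔸/ℚ is
discrete, so the bijection from ℚ is a homeomorphism. -/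

theorem norm_padicFract_le_one_of_ne {p l : ℕ} [Fact p.Prime] [Fact l.Prime] (h : p ≠ l)
    (x : ℚ_[p]) : ‖(padicFract p x : ℚ_[l])‖ ≤ 1 := by
  obtain ⟨a, m, ha⟩ := exists_padicFract_eq_div_pow x
  have hp : ‖(p : ℚ_[l])‖ = 1 := by
    rw [Padic.norm_natCast_eq_one_iff]
    exact (Nat.coprime_primes Fact.out Fact.out).2 h.symm
  rw [ha, Rat.cast_div, Rat.cast_pow, Rat.cast_natCast, Rat.cast_natCast, norm_div, norm_pow, hp,
    one_pow, div_one]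
  exact_mod_cast Padic.norm_int_le_one (p := l) a

theorem Rat.exists_int_eq_of_forall_padic_norm_le_one {q : ℚ}
    (h : ∀ p : Nat.Primes, ‖(q : ℚ_[(p : ℕ)])‖ ≤ 1) : ∃ k : ℤ, q = k := by
  refine ⟨q.num, (Rat.den_eq_one_iff q).1 ?_ |>.symm⟩
  by_contra hd
  obtain ⟨p, hp, hpd⟩ := Nat.exists_prime_and_dvd hd
  have := Fact.mk hp
  refine absurd (h ⟨p, hp⟩) (not_le.2 ?_)
  have hnum : ‖(q.num : ℚ_[p])‖ = 1 := by
    refine le_antisymm (Padic.norm_int_le_one _) (not_lt.1 fun hlt => ?_)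
    have h1 := (Padic.norm_intCast_lt_one_iff).1 hlt
    exact hp.not_dvd_one (q.reduced ▸ Nat.dvd_gcd (Int.natCast_dvd.1 h1) hpd)
  have hden : ‖(q.den : ℚ_[p])‖ < 1 := (Padic.norm_natCast_lt_one_iff).2 hpd
  have hden0 : 0 < ‖(q.den : ℚ_[p])‖ := norm_pos_iff.2 (Nat.cast_ne_zero.2 q.den_nz)
  show 1 < ‖(q : ℚ_[p])‖
  rw [Rat.cast_def, norm_div, hnum]
  exact (one_lt_div hden0).2 hden

theorem finite_support_padicFract (x : RatFiniteAdele) :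
    (Function.support fun p : Nat.Primes => padicFract (p : ℕ) (x p)).Finite := by
  have h := x.eventually
  rw [Filter.eventually_cofinite] at h
  exact h.subset fun p hp hx => hp (padicFract_eq_zero hx)

/-- The sum of the fractional parts of the components of a finite adele. -/
noncomputable def finiteAdeleFract (x : RatFiniteAdele) : ℚ :=
  ∑ᶠ p : Nat.Primes, padicFract (p : ℕ) (x p)

theorem norm_sub_finiteAdeleFract_le_one (x : RatFiniteAdele) (l : Nat.Primes) :
    ‖x l - (finiteAdeleFract x : ℚ_[(l : ℕ)])‖ ≤ 1 := by
  -- Inserting `l` lets its term be split off even when it vanishes; the other terms have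
  -- denominators prime to `l`.
  set s := insert l (finite_support_padicFract x).toFinset with hs
  have hsum : finiteAdeleFract x = ∑ p ∈ s, padicFract (p : ℕ) (x p) :=
    finsum_eq_sum_of_support_subset _ fun p hp => by simpa [hs] using Or.inr hp
  rw [hsum, ← Finset.add_sum_erase _ _ (Finset.mem_insert_self _ _), Rat.cast_add, Rat.cast_sum,
    ← sub_sub]
  refine (PadicInt.subring (l : ℕ)).sub_mem (norm_sub_padicFract_le_one (x l))
    ((PadicInt.subring (l : ℕ)).sum_mem fun p hp => ?_)
  exact norm_padicFract_le_one_of_ne (fun h => (Finset.mem_erase.1 hp).1 (Subtype.ext h)) _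

theorem finiteAdeleChar_eq_exp (x : RatFiniteAdele) :
    finiteAdeleChar x = Circle.exp (2 * Real.pi * (finiteAdeleFract x : ℝ)) := by
  set s := (finite_support_padicFract x).toFinset with hs
  have hsum : finiteAdeleFract x = ∑ p ∈ s, padicFract (p : ℕ) (x p) :=
    finsum_eq_sum_of_support_subset _ fun p hp => by simpa [hs] using hp
  have hprod : finiteAdeleChar x = ∏ p ∈ s, padicChar (p : ℕ) (x p) :=
    finprod_eq_prod_of_mulSupport_subset _ fun p hp => by
      simp only [hs, Set.Finite.coe_toFinset, Function.mem_support]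
      intro h0
      exact hp (by simp [padicChar, h0])
  rw [hsum, hprod, Rat.cast_sum, Finset.mul_sum]
  clear hsum hprod hs
  induction s using Finset.induction_on with
  | empty => simp
  | insert a s ha ih => rw [Finset.prod_insert ha, Finset.sum_insert ha, Circle.exp_add, ih]; rfl

theorem ratAdeleChar_apply (x : RatAdele) :
    ratAdeleChar (Multiplicative.ofAdd x) = finiteAdeleChar x.1 * realChar x.2 := rfl

theorem ratAdeleDiag_fst_apply (q : ℚ) (p : Nat.Primes) :
    (ratAdeleDiag q).1 p = (q : ℚ_[(p : ℕ)]) := rfl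

theorem ratAdeleDiag_snd (q : ℚ) : (ratAdeleDiag q).2 = (q : ℝ) := rfl

/-- The difference between `q` and the sum of its fractional parts is integral at every prime, hence
an integer, which the exponential does not see. -/
theorem ratAdeleChar_ratAdeleDiag (q : ℚ) :
    ratAdeleChar (Multiplicative.ofAdd (ratAdeleDiag q)) = 1 := by
  obtain ⟨k, hk⟩ := Rat.exists_int_eq_of_forall_padic_norm_le_one
    (q := q - finiteAdeleFract (ratAdeleDiag q).1) fun p => by
      have h := norm_sub_finiteAdeleFract_le_one (ratAdeleDiag q).1 p
      rwa [ratAdeleDiag_fst_apply, ← Rat.cast_sub] at h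
  have hk' : (q : ℝ) - (finiteAdeleFract (ratAdeleDiag q).1 : ℝ) = k := by exact_mod_cast hk
  rw [ratAdeleChar_apply, finiteAdeleChar_eq_exp, realChar, ← Circle.exp_add, Circle.exp_eq_one,
    ratAdeleDiag_snd]
  exact ⟨-k, by push_cast; rw [← hk']; ring⟩

/-- Every adele is a rational number plus an adele whose finite components are integral and whose
real component lies in `[0, 1]`. -/
theorem exists_rat_add_eq (x : RatAdele) : ∃ (q : ℚ) (y : RatAdele),
    (∀ p : Nat.Primes, y.1 p ∈ PadicInt.subring (p : ℕ)) ∧ y.2 ∈ Set.Icc (0 : ℝ) 1 ∧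
      x = ratAdeleDiag q + y := by
  set q := finiteAdeleFract x.1
  set k := ⌊x.2 - q⌋
  -- Since `k` is an integer, correcting the real component by it keeps the finite components
  -- integral.
  refine ⟨q + k, x - ratAdeleDiag (q + k), fun p => ?_, ?_, by abel⟩
  · have h : (x - ratAdeleDiag (q + k)).1 p = (x.1 p - (q : ℚ_[(p : ℕ)])) - (k : ℚ_[(p : ℕ)]) := by
      have h1 : (x - ratAdeleDiag (q + k)).1 p = x.1 p - ((q + k : ℚ) : ℚ_[(p : ℕ)]) := rfl
      rw [h1]
      push_cast
      ring
    rw [h]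
    exact (PadicInt.subring (p : ℕ)).sub_mem (norm_sub_finiteAdeleFract_le_one x.1 p)
      (intCast_mem _ k)
  · have h : (x - ratAdeleDiag (q + k)).2 = Int.fract (x.2 - q) := by
      have h1 : (x - ratAdeleDiag (q + k)).2 = x.2 - ((q + k : ℚ) : ℝ) := rfl
      rw [h1, ← Int.self_sub_floor]
      push_cast
      ring
    rw [h]
    exact ⟨Int.fract_nonneg _, (Int.fract_lt_one _).le⟩

/-! ### Compactness -/

theorem isCompact_integralFiniteAdele :
    IsCompact {x : RatFiniteAdele | ∀ p : Nat.Primes, x p ∈ PadicInt.subring (p : ℕ)} := by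
  have (p : Nat.Primes) : CompactSpace (PadicInt.subring (p : ℕ)) :=
    inferInstanceAs (CompactSpace ℤ_[(p : ℕ)])
  have h : {x : RatFiniteAdele | ∀ p : Nat.Primes, x p ∈ PadicInt.subring (p : ℕ)} =
      Set.range (RestrictedProduct.structureMap (fun p : Nat.Primes => ℚ_[(p : ℕ)])
        (fun p => (PadicInt.subring (p : ℕ) : Set ℚ_[(p : ℕ)])) Filter.cofinite) :=
    (RestrictedProduct.range_structureMap _ _).symm
  rw [h]
  have : CompactSpace (∀ p : Nat.Primes, (PadicInt.subring (p : ℕ) : Set ℚ_[(p : ℕ)])) :=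
    inferInstanceAs (CompactSpace (∀ p : Nat.Primes, PadicInt.subring (p : ℕ)))
  exact isCompact_range RestrictedProduct.isEmbedding_structureMap.continuous

instance instCompactSpaceRatAdeleClassGroup : CompactSpace RatAdeleClassGroup := by
  refine ⟨((isCompact_integralFiniteAdele.prod (isCompact_Icc (a := (0 : ℝ)) (b := 1))).image
    (QuotientAddGroup.continuous_mk (N := ratPrincipalAdele))).of_isClosed_subset isClosed_univ
      fun x _ => ?_⟩
  obtain ⟨x, rfl⟩ := QuotientAddGroup.mk_surjective x
  obtain ⟨q, y, hy, hy', rfl⟩ := exists_rat_add_eq x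
  have hq : (ratAdeleDiag q : RatAdeleClassGroup) = 0 := (QuotientAddGroup.eq_zero_iff _).2 ⟨q, rfl⟩
  refine ⟨y, ⟨hy, hy'⟩, ?_⟩
  rw [QuotientAddGroup.mk_add, hq, zero_add]

/-! ### Characters of the real line -/

/-- Lift `φ` through the covering `Circle.exp`: the lift vanishing at 0 is additive and continuous,
hence linear. -/
theorem exists_eq_exp_of_continuous {φ : ℝ → Circle} (hφ : Continuous φ)
    (hadd : ∀ x y, φ (x + y) = φ x * φ y) : ∃ c : ℝ, ∀ x, φ x = Circle.exp (x * c) := by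
  have h0 : φ 0 = 1 := by
    have h := hadd 0 0
    rw [add_zero] at h
    exact left_eq_mul.1 h
  obtain ⟨F, ⟨hF0, hF⟩, huniq⟩ := Circle.isCoveringMap_exp.existsUnique_continuousMap_lifts
    (⟨φ, hφ⟩ : C(ℝ, Circle)) 0 0 (by simp [h0])
  have hF' (x : ℝ) : Circle.exp (F x) = φ x := congrFun hF x
  have hFadd (x y : ℝ) : F (x + y) = F x + F y := by
    -- The translated lift also covers `φ` and vanishes at 0, so uniqueness of lifts yields
    -- additivity.
    have h := huniq ⟨fun x => F (x + y) - F y, by fun_prop⟩ ⟨by simp, by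
      funext x
      simp [Circle.exp_sub, hF', hadd]⟩
    have := DFunLike.congr_fun h x
    simp only [ContinuousMap.coe_mk] at this
    linarith
  refine ⟨F 1, fun x => ?_⟩
  have h := map_real_smul (AddMonoidHom.mk' F hFadd) F.continuous x 1
  simp only [smul_eq_mul, mul_one, AddMonoidHom.mk'_apply] at h
  rw [← h, hF']

/-! ### The annihilator of the principal adeles -/

theorem ratAdeleCharMul_ratAdeleDiag_mem_unitaryAnnihilator (q : ℚ) :
    ratAdeleCharMul (ratAdeleDiag q) ∈ unitaryAnnihilator ratPrincipalAdele := by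
  rintro _ ⟨r, rfl⟩
  have h : ratAdeleDiag q * ratAdeleDiag r = ratAdeleDiag (q * r) := (map_mul _ _ _).symm
  exact (ratAdeleCharMul_apply _ _).trans
    ((congrArg (fun z => ratAdeleChar (Multiplicative.ofAdd z)) h).trans
      (ratAdeleChar_ratAdeleDiag _))

/-- Each p^m divides n! for large n. Componentwise convergence suffices because all terms lie in ∏
ℤ_p, which embeds with its product topology. -/
theorem tendsto_factorial_finiteAdele :
    Filter.Tendsto (fun n : ℕ => ((n.factorial : ℕ) : RatFiniteAdele)) Filter.atTop (nhds 0) := by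
  have h : Filter.Tendsto (fun (n : ℕ) (p : Nat.Primes) =>
      (((n.factorial : ℕ) : PadicInt.subring (p : ℕ)) : PadicInt.subring (p : ℕ)))
      Filter.atTop (nhds 0) := by
    refine tendsto_pi_nhds.2 fun p => ?_
    refine Metric.tendsto_atTop.2 fun ε hε => ?_
    obtain ⟨m, hm⟩ := PadicInt.exists_pow_neg_lt (p : ℕ) hε
    refine ⟨(p : ℕ) ^ m, fun n hn => ?_⟩
    rw [Pi.zero_apply, dist_zero_right]
    refine lt_of_le_of_lt ?_ hm
    refine (PadicInt.norm_le_pow_iff_mem_span_pow (p := (p : ℕ)) _ m).2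
      (Ideal.mem_span_singleton.2 ?_)
    have hd : (p : ℕ) ^ m ∣ n.factorial := Nat.dvd_factorial (pow_pos p.2.pos m) hn
    have := Nat.cast_dvd_cast (α := ℤ_[(p : ℕ)]) hd
    rwa [Nat.cast_pow] at this
  exact (RestrictedProduct.isEmbedding_structureMap.continuous.tendsto
    (X := ∀ p : Nat.Primes, (PadicInt.subring (p : ℕ) : Set ℚ_[(p : ℕ)])) 0).comp h

/-- By compactness of ∏ ℤ_p, `φ` maps a·∏ ℤ_p into a small arc for all `a` near 0, in particular for
some a = n!. The image is a subgroup of the circle, hence trivial. -/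
theorem exists_pos_forall_natCast_mul_eq_one {φ : RatFiniteAdele → Circle} (hφ : Continuous φ)
    (hadd : ∀ x y, φ (x + y) = φ x * φ y) :
    ∃ N : ℕ, 0 < N ∧ ∀ x : RatFiniteAdele,
      (∀ p : Nat.Primes, x p ∈ PadicInt.subring (p : ℕ)) → φ (N * x) = 1 := by
  have h0 : φ 0 = 1 := by
    have h := hadd 0 0
    rw [add_zero] at h
    exact left_eq_mul.1 h
  have hnsmul (n : ℕ) (x : RatFiniteAdele) : φ (n * x) = φ x ^ n := by
    induction n with
    | zero => simp [h0]
    | succ n ih => rw [Nat.cast_succ, add_one_mul, hadd, ih, pow_succ]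
  have hev := isCompact_integralFiniteAdele.eventually_forall_of_forall_eventually
    (x₀ := (0 : RatFiniteAdele)) (P := fun a x => φ (a * x) ∈ Circle.centeredArc (Real.pi / 2))
    fun x _ => by
      have hc : Continuous fun z : RatFiniteAdele × RatFiniteAdele => φ (z.1 * z.2) := by fun_prop
      refine hc.continuousAt.eventually ((Circle.isOpen_centeredArc _).mem_nhds ?_)
      show φ (0 * x) ∈ _
      rw [zero_mul, h0, Circle.mem_centeredArc (by linarith [Real.pi_pos])]
      simp [Real.pi_pos]
  obtain ⟨n, hn⟩ := (tendsto_factorial_finiteAdele.eventually hev).exists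
  refine ⟨n.factorial, n.factorial_pos, fun x hx => ?_⟩
  refine Circle.eq_one_of_forall_pow_mem_centeredArc_pi_div_two fun m _ => ?_
  rw [← hnsmul, mul_left_comm]
  exact hn (m * x) fun p =>
    (PadicInt.subring (p : ℕ)).mul_mem (natCast_mem _ m) (hx p)

theorem eq_ratAdeleCharMul_of_mem_unitaryAnnihilator {χ : UnitaryDual RatAdele}
    (hχ : χ ∈ unitaryAnnihilator ratPrincipalAdele) :
    ∃ q : ℚ, χ = ratAdeleCharMul (ratAdeleDiag q) := by
  set ψ : RatAdele → Circle := fun x => χ (Multiplicative.ofAdd x)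
  have hadd (x y : RatAdele) : ψ (x + y) = ψ x * ψ y := map_mul χ _ _
  have hcont : Continuous ψ := (map_continuous χ).comp continuous_ofAdd
  have hrat (q : ℚ) : ψ (ratAdeleDiag q) = 1 := hχ _ ⟨q, rfl⟩
  obtain ⟨N, hN, hint⟩ := exists_pos_forall_natCast_mul_eq_one
    (φ := fun x => ψ (x, 0)) (by fun_prop) fun x y => by rw [← hadd]; simp
  have hsplit (x : RatAdele) : x = (x.1, 0) + (0, x.2) := by simp
  -- Rescaling by `N` places the known value ψ(0, N) = 1 at r = 1.
  obtain ⟨c, hc⟩ := exists_eq_exp_of_continuous (φ := fun r => ψ (0, N * r)) (by fun_prop)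
    fun x y => by rw [← hadd]; simp [mul_add]
  have hc1 : ψ (0, N * 1) = 1 := by
    have h := hrat N
    rw [hsplit (ratAdeleDiag N), hadd] at h
    have h1 : (ratAdeleDiag N).1 = N * 1 := by rw [map_natCast, mul_one]; rfl
    have h2 : (ratAdeleDiag N).2 = N * 1 := by rw [map_natCast, mul_one]; rfl
    rwa [h1, h2, hint 1 fun p => (PadicInt.subring (p : ℕ)).one_mem, one_mul] at h
  obtain ⟨k, hk⟩ := Circle.exp_eq_one.1 ((hc 1).symm.trans hc1)
  rw [one_mul] at hk
  have hN0 : (N : ℚ) ≠ 0 := Nat.cast_ne_zero.2 hN.ne'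
  -- The sign compensates for the one in χ_∞.
  refine ⟨-k / N, PontryaginDual.ext fun x => ?_⟩
  -- Decomposing x/N instead of x makes the finite remainder land in N·∏ ℤ_p after multiplying back.
  obtain ⟨q, y, hy, -, hqy⟩ := exists_rat_add_eq (ratAdeleDiag (N : ℚ)⁻¹ * x.toAdd)
  have hx : x.toAdd = ratAdeleDiag (N * q) + (((N : RatFiniteAdele) * y.1, 0) + (0, N * y.2)) := by
    have h : x.toAdd = ratAdeleDiag N * (ratAdeleDiag (N : ℚ)⁻¹ * x.toAdd) := by
      rw [← mul_assoc, ← map_mul, mul_inv_cancel₀ hN0, map_one, one_mul]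
    rw [h, hqy, mul_add, ← map_mul, map_natCast]
    congr 1
    refine Prod.ext ?_ ?_ <;> simp
  have hl : ψ x.toAdd = Circle.exp (y.2 * (k * (2 * Real.pi))) := by
    rw [hx, hadd, hadd, hrat, hint _ hy, hc, hk, one_mul, one_mul]
  refine hl.trans ?_
  have hr : ratAdeleDiag (-k / N) * x.toAdd
      = ratAdeleDiag (-k * q) + ratAdeleDiag (-k) * y := by
    rw [div_eq_mul_inv, map_mul, mul_assoc, hqy, mul_add, ← map_mul]
  have hfin : finiteAdeleChar (ratAdeleDiag (-k) * y).1 = 1 :=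
    finprod_eq_one_of_forall_eq_one fun p => padicChar_eq_one <| by
      have h : (ratAdeleDiag (-k) * y).1 p = -(k : ℚ_[(p : ℕ)]) * y.1 p := by
        have h1 : (ratAdeleDiag (-k) * y).1 p = ((-k : ℚ) : ℚ_[(p : ℕ)]) * y.1 p := rfl
        rw [h1]
        push_cast
        rfl
      rw [h]
      exact (PadicInt.subring (p : ℕ)).mul_mem ((PadicInt.subring (p : ℕ)).neg_mem
        (intCast_mem _ k)) (hy p)
  have hreal : (ratAdeleDiag (-k) * y).2 = -k * y.2 := by
    have h1 : (ratAdeleDiag (-k) * y).2 = ((-k : ℚ) : ℝ) * y.2 := rfl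
    rw [h1]
    push_cast
    rfl
  have : ratAdeleCharMul (ratAdeleDiag (-k / N)) x
      = ratAdeleChar (Multiplicative.ofAdd (ratAdeleDiag (-k / N) * x.toAdd)) := rfl
  rw [this, hr, ofAdd_add, map_mul ratAdeleChar, ratAdeleChar_ratAdeleDiag, one_mul,
    ratAdeleChar_apply, hfin, one_mul, hreal, realChar]
  congr 1
  ring

theorem eq_zero_of_forall_realChar_mul {a : ℝ} (h : ∀ r : ℝ, realChar (a * r) = 1) : a = 0 := by
  by_contra ha
  -- The test point makes the argument 1/2, where χ_∞ equals -1.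
  obtain ⟨n, hn⟩ := Circle.exp_eq_one.1 (h (a⁻¹ * 2⁻¹))
  rw [mul_inv_cancel_left₀ ha] at hn
  have h1 : (-1 : ℝ) = 2 * n := by
    have := Real.pi_pos.ne'
    field_simp at hn
    linarith
  have h2 : (-1 : ℤ) = 2 * n := by exact_mod_cast h1
  omega

/-- The fractional part is then an integer in [0, 1), hence 0. -/
theorem norm_le_one_of_padicChar_eq_one {p : ℕ} [Fact p.Prime] {x : ℚ_[p]}
    (h : padicChar p x = 1) : ‖x‖ ≤ 1 := by
  obtain ⟨n, hn⟩ := Circle.exp_eq_one.1 h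
  have h1 : (padicFract p x : ℝ) = n := by
    have := Real.pi_pos
    refine mul_left_cancel₀ (b := (padicFract p x : ℝ)) (a := 2 * Real.pi) (by positivity) ?_
    rw [hn, mul_comm]
  have h2 : padicFract p x = n := by exact_mod_cast h1
  have h3 := padicFract_nonneg x
  have h4 := padicFract_lt_one x
  rw [h2] at h3 h4
  have h5 : n = 0 := le_antisymm (Int.lt_add_one_iff.1 (by exact_mod_cast h4))
    (by exact_mod_cast h3)
  have h6 := norm_sub_padicFract_le_one x
  rwa [h2, h5, Int.cast_zero, Rat.cast_zero, sub_zero] at h6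

theorem eq_zero_of_forall_padicChar_mul {p : ℕ} [Fact p.Prime] {a : ℚ_[p]}
    (h : ∀ x : ℚ_[p], padicChar p (a * x) = 1) : a = 0 := by
  by_contra ha
  -- The test point makes the argument 1/p, which has norm p > 1.
  have h1 := norm_le_one_of_padicChar_eq_one (h (a⁻¹ * (p : ℚ_[p])⁻¹))
  rw [mul_inv_cancel_left₀ ha, norm_inv, Padic.norm_p, inv_inv] at h1
  exact absurd h1 (not_le.2 (by exact_mod_cast (Fact.out : p.Prime).one_lt))

/-- The pairing `(t, x) ↦ χ_ℚ(t x)` on the adeles is nondegenerate. -/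
theorem eq_zero_of_forall_ratAdeleChar_mul {t : RatAdele}
    (h : ∀ x : RatAdele, ratAdeleChar (Multiplicative.ofAdd (t * x)) = 1) : t = 0 := by
  refine Prod.ext (RestrictedProduct.ext _ _ fun p => ?_) ?_
  · refine eq_zero_of_forall_padicChar_mul fun x => ?_
    -- Adeles supported at a single place reduce the claim to the local characters.
    have h1 := h (RestrictedProduct.single (fun p : Nat.Primes => PadicInt.subring (p : ℕ)) p x, 0)
    rw [ratAdeleChar_apply, Prod.snd_mul, mul_zero, realChar, mul_zero, neg_zero, Circle.exp_zero,
      mul_one, Prod.fst_mul] at h1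
    replace h1 : finiteAdeleChar (t.1 * RestrictedProduct.single
      (fun p : Nat.Primes => PadicInt.subring (p : ℕ)) p x) = 1 := h1
    rw [← RestrictedProduct.mul_single] at h1
    rw [← h1, finiteAdeleChar, finprod_eq_single _ p, RestrictedProduct.single_eq_same]
    intro l hl
    rw [RestrictedProduct.single_eq_of_ne _ _ hl]
    exact padicChar_eq_one (by simp)
  · refine eq_zero_of_forall_realChar_mul fun r => ?_
    have h1 := h (0, r)
    rwa [ratAdeleChar_apply, Prod.fst_mul, mul_zero, Prod.snd_mul, finiteAdeleChar,
      finprod_eq_one_of_forall_eq_one fun p => padicChar_eq_one (by simp), one_mul] at h1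

theorem ratAdeleCharMul_injective : Function.Injective ratAdeleCharMul := by
  intro s t hst
  refine sub_eq_zero.1 (eq_zero_of_forall_ratAdeleChar_mul fun x => ?_)
  have h : ratAdeleChar (Multiplicative.ofAdd (s * x)) =
      ratAdeleChar (Multiplicative.ofAdd (t * x)) :=
    DFunLike.congr_fun hst (Multiplicative.ofAdd x)
  rw [sub_mul, ofAdd_sub, map_div, h, div_self']

/-! ### The dual of the adele class group -/

/-- The character of `G/H` induced by a character of `G` that is trivial on `H`. -/
noncomputable def unitaryAnnihilatorToDual {G : Type*} [AddCommGroup G] [TopologicalSpace G]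
    (H : AddSubgroup G) : unitaryAnnihilator H →* UnitaryDual (G ⧸ H) where
  toFun χ := (
    { toFun := fun x => Quotient.lift (fun g : G => (χ : UnitaryDual G) (Multiplicative.ofAdd g))
        (fun a b hab => by
          have h := χ.2 _ (QuotientAddGroup.leftRel_apply.1 hab)
          rw [ofAdd_add, map_mul, ofAdd_neg, map_inv, inv_mul_eq_one] at h
          exact h) x.toAdd
      map_one' := map_one (χ : UnitaryDual G)
      map_mul' := fun x y => by
        induction x using Multiplicative.rec with | _ x =>
        induction y using Multiplicative.rec with | _ y =>
        obtain ⟨x, rfl⟩ := QuotientAddGroup.mk_surjective x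
        obtain ⟨y, rfl⟩ := QuotientAddGroup.mk_surjective y
        exact map_mul (χ : UnitaryDual G) (Multiplicative.ofAdd x) (Multiplicative.ofAdd y)
      continuous_toFun := (Continuous.quotient_lift
        ((map_continuous (χ : UnitaryDual G)).comp continuous_ofAdd) _).comp continuous_toAdd } :
    Multiplicative (G ⧸ H) →ₜ* Circle)
  map_one' := PontryaginDual.ext fun x => by
    induction x using Multiplicative.rec with | _ x =>
    obtain ⟨x, rfl⟩ := QuotientAddGroup.mk_surjective x
    rfl
  map_mul' χ ψ := PontryaginDual.ext fun x => by
    induction x using Multiplicative.rec with | _ x =>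
    obtain ⟨x, rfl⟩ := QuotientAddGroup.mk_surjective x
    rfl

theorem unitaryAnnihilatorToDual_surjective {G : Type*} [AddCommGroup G] [TopologicalSpace G]
    (H : AddSubgroup G) : Function.Surjective (unitaryAnnihilatorToDual H) := by
  intro η
  let π : Multiplicative G →ₜ* Multiplicative (G ⧸ H) :=
    { toFun := fun x => Multiplicative.ofAdd (x.toAdd : G ⧸ H)
      map_one' := rfl
      map_mul' := fun _ _ => rfl
      continuous_toFun :=
        continuous_ofAdd.comp (QuotientAddGroup.continuous_mk.comp continuous_toAdd) }
  refine ⟨⟨PontryaginDual.map π η, fun h hh => ?_⟩, PontryaginDual.ext fun x => ?_⟩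
  · have h0 : (h : G ⧸ H) = 0 := (QuotientAddGroup.eq_zero_iff h).2 hh
    have h1 : PontryaginDual.map π η (Multiplicative.ofAdd h)
        = η (Multiplicative.ofAdd (h : G ⧸ H)) := rfl
    rw [h1, h0, ofAdd_zero, map_one]
  · induction x using Multiplicative.rec with | _ x =>
    obtain ⟨x, rfl⟩ := QuotientAddGroup.mk_surjective x
    rfl

/-- The homomorphism `q ↦ χ_{ℚ,q}` from `ℚ` to the dual of the adele class group. -/
noncomputable def ratToDualAdeleClassGroup :
    Multiplicative ℚ →* UnitaryDual RatAdeleClassGroup :=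
  (unitaryAnnihilatorToDual ratPrincipalAdele).comp
    { toFun := fun q => ⟨ratAdeleCharMul (ratAdeleDiag q.toAdd),
        ratAdeleCharMul_ratAdeleDiag_mem_unitaryAnnihilator _⟩
      map_one' := Subtype.ext <| PontryaginDual.ext fun x => by
        show ratAdeleChar (Multiplicative.ofAdd (ratAdeleDiag 0 * x.toAdd)) = 1
        rw [map_zero, zero_mul, ofAdd_zero, map_one ratAdeleChar]
      map_mul' := fun q r => Subtype.ext <| PontryaginDual.ext fun x => by
        show ratAdeleChar (Multiplicative.ofAdd (ratAdeleDiag (q.toAdd + r.toAdd) * x.toAdd)) =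
          ratAdeleChar (Multiplicative.ofAdd (ratAdeleDiag q.toAdd * x.toAdd)) *
            ratAdeleChar (Multiplicative.ofAdd (ratAdeleDiag r.toAdd * x.toAdd))
        rw [map_add, add_mul, ofAdd_add, map_mul ratAdeleChar] }

theorem ratToDualAdeleClassGroup_apply (q : ℚ) (x : RatAdele) :
    ratToDualAdeleClassGroup (Multiplicative.ofAdd q)
        (Multiplicative.ofAdd (x : RatAdeleClassGroup)) =
      ratAdeleChar (Multiplicative.ofAdd (ratAdeleDiag q * x)) := rfl

theorem ratToDualAdeleClassGroup_bijective : Function.Bijective ratToDualAdeleClassGroup := by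
  refine ⟨fun q r hqr => ?_, fun η => ?_⟩
  · have h : ratAdeleCharMul (ratAdeleDiag q.toAdd) = ratAdeleCharMul (ratAdeleDiag r.toAdd) :=
      PontryaginDual.ext fun x =>
        DFunLike.congr_fun hqr (Multiplicative.ofAdd (x.toAdd : RatAdeleClassGroup))
    exact Multiplicative.toAdd.injective (ratAdeleDiag.injective (ratAdeleCharMul_injective h))
  · obtain ⟨⟨χ, hχ⟩, rfl⟩ := unitaryAnnihilatorToDual_surjective ratPrincipalAdele η
    obtain ⟨q, rfl⟩ := eq_ratAdeleCharMul_of_mem_unitaryAnnihilator hχ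
    exact ⟨Multiplicative.ofAdd q, rfl⟩

theorem mainTheorem4 :
    -- `ℚ` carries the discrete topology `⊥`
    (∃ e : @ContinuousMulEquiv (Multiplicative ℚ) (⊥ : TopologicalSpace (Multiplicative ℚ))
        (UnitaryDual RatAdeleClassGroup) inferInstance inferInstance inferInstance,
      ∀ (q : ℚ) (x : RatAdele),
        e (Multiplicative.ofAdd q) (Multiplicative.ofAdd (x : RatAdeleClassGroup)) =
          ratAdeleChar (Multiplicative.ofAdd (ratAdeleDiag q * x))) ∧
    (∀ χ : UnitaryDual RatAdele,
      χ ∈ unitaryAnnihilator ratPrincipalAdele ↔ ∃ q : ℚ, χ = ratAdeleCharMul (ratAdeleDiag q)) ∧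
    (∀ t : RatAdele,
      ratAdeleCharMul t ∈ unitaryAnnihilator ratPrincipalAdele ↔ t ∈ ratPrincipalAdele) := by
  refine ⟨?_, fun χ => ⟨eq_ratAdeleCharMul_of_mem_unitaryAnnihilator, ?_⟩,
    fun t => ⟨fun h => ?_, ?_⟩⟩
  · let _ : TopologicalSpace (Multiplicative ℚ) := ⊥
    have : DiscreteTopology (Multiplicative ℚ) := ⟨rfl⟩
    have : CompactSpace (Multiplicative RatAdeleClassGroup) :=
      inferInstanceAs (CompactSpace RatAdeleClassGroup)
    -- Continuity of the inverse uses that the dual of a compact group is discrete.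
    exact ⟨{ MulEquiv.ofBijective _ ratToDualAdeleClassGroup_bijective with
      continuous_toFun := continuous_of_discreteTopology
      continuous_invFun := continuous_of_discreteTopology }, ratToDualAdeleClassGroup_apply⟩
  · rintro ⟨q, rfl⟩
    exact ratAdeleCharMul_ratAdeleDiag_mem_unitaryAnnihilator q
  · obtain ⟨q, hq⟩ := eq_ratAdeleCharMul_of_mem_unitaryAnnihilator h
    exact ⟨q, (ratAdeleCharMul_injective hq).symm⟩
  · rintro ⟨q, rfl⟩
    exact ratAdeleCharMul_ratAdeleDiag_mem_unitaryAnnihilator q
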